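/- Let $\Theta$ be a measurable space, $\eta$ a probability measure on $\Theta$, and $\mu(\cdot\,|\,\theta)$, $\theta\in\Theta$, a Markov kernel from $\Theta$ to $\mathbb R$ such that every $\mu(\cdot\,|\,\theta)$ is concentrated on $[0,1]$. Let $\bar\mu=\int_\Theta \mu(\cdot\,|\,\theta)\,d\eta(\theta)$, let $q\in[0,1]$ and $y\in\mathbb R$. For agents' positions $\vec x=(x_1,\dots,x_n)$ and a facility at $y$ accommodating the $\lfloor qn\rfloor$ agents closest to $y$ (ties broken arbitrarily), the (per-agent) social welfare is $SW(\vec x;y)=\frac1n\sum_{i}(1-|x_i-y|)$, the sum running over the accommodated agents. For a probability measure $\mu$ and a positive measure $\nu$ on $\mathbb R$ with $\nu(\mathbb R)\le 1$, let $W_1(\mu,\nu)=\inf_\pi\int_{\mathbb R\times\mathbb R}|x-z|\,d\pi(x,z)$, the infimum over all probability measures $\pi$ on $\mathbb R\times\mathbb R$ with first marginal $\mu$ and second marginal $\ge\nu$ (setwise). Let $(\theta_i,X_i)$, $i\ge 1$, be independent random vectors, each with law $\eta(d\theta)\,\mu(dx\,|\,\theta)$, and put $\vec X_n=(X_1,\dots,X_n)$.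 Then $W_1(\bar\mu,q\delta_y)<\infty$, the expectations below are of integrable functions, and: 1. $\displaystyle\lim_{n\to\infty}\mathbb E[SW(\vec X_n;y)]=q-W_1(\bar\mu,q\delta_y)$. 2. For almost every realization of the types $(\theta_i)_{i\ge1}$, if the agents are independent, the $i$-th with law $\mu(\cdot\,|\,\theta_i)$ (so in general not identically distributed), the expected welfare, taken over the positions only, has the same limit: $\displaystyle\lim_{n\to\infty}\int SW(\vec x;y)\,d\Big(\bigotimes_{i=1}^n\mu(\cdot\,|\,\theta_i)\Big)(\vec x)=q-W_1(\bar\mu,q\delta_y)$. 3. For every $n$ the law of $\vec X_n$ is $\bar\mu^{\otimes n}$, so the model is that of i.i.d. agents with law $\mu$ replaced by $\bar\mu$. -/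

import Mathlib

open MeasureTheory ProbabilityTheory Filter Topology
open scoped ENNReal

noncomputable section

/-- The priority of agent `i` at a facility located at `y`: the number of agents served before `i`
under the first-come-first-served rule, i.e. those strictly closer to `y`, and among the equally
distant ones those with a smaller index. (How ties are broken does not affect the welfare.) -/
def fcfsRank {n : ℕ} (y : ℝ) (x : Fin n → ℝ) (i : Fin n) : ℕ :=
  (Finset.univ.filter fun j : Fin n =>
    |x j - y| < |x i - y| ∨ (|x j - y| = |x i - y| ∧ j < i)).card

/-- The utility of agent `i`: the `⌊q n⌋` agents closest to `y` are accommodated and get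
`1 - |x i - y|`, the others get `0`. -/
def agentUtility {n : ℕ} (q y : ℝ) (x : Fin n → ℝ) (i : Fin n) : ℝ :=
  if fcfsRank y x i < ⌊q * (n : ℝ)⌋₊ then 1 - |x i - y| else 0

/-- The (per-agent) social welfare of a facility of capacity `q` located at `y`. -/
def socialWelfare {n : ℕ} (q y : ℝ) (x : Fin n → ℝ) : ℝ :=
  (1 / (n : ℝ)) * ∑ i, agentUtility q y x i

/-- Transportation plans between a probability measure `μ` and a positive measure `ν` of total mass
at most one: probability measures on `ℝ × ℝ` with first marginal `μ` and second marginal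
dominating `ν` setwise. -/
def transportPlans (μ ν : Measure ℝ) : Set (Measure (ℝ × ℝ)) :=
  {π | IsProbabilityMeasure π ∧ π.fst = μ ∧ ν ≤ π.snd}

/-- The (unbalanced) Wasserstein distance of order one. -/
def wassersteinOne (μ ν : Measure ℝ) : ℝ≥0∞ :=
  ⨅ π ∈ transportPlans μ ν, ∫⁻ p, ENNReal.ofReal |p.1 - p.2| ∂π

end

/-! ### Ranks and accommodated agents -/

/-! Serving the closest agents is a linear program, and so is the transport of mass `q` to `y`; both
have the same dual, with one multiplier `t`. The sum of the `k` smallest distances `d i` is the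
maximum over `t` of `k * t - ∑ i, max (t - d i) 0`, and for `0 ≤ q ≤ 1` the distance from `μ` to `q
δ_y` is the maximum over `t ≥ 0` of `q * t - ∫ max (t - |z - y|) 0 ∂μ`, attained at a `q`-quantile
`t` of the distance to `y` (`wassersteinOne_smul_dirac`).

Let `t` be such a quantile for the mixture. At this fixed `t`, the welfare differs from its claimed
limit by at most a rounding error plus the deviations of three empirical averages: those of `max (t
- |z - y|) 0` and of the indicators of the open and the closed ball of radius `t`
(`abs_socialWelfare_sub_le`). A variance bound makes these deviations tend to `0` in mean for
independent agents, identically distributed or not, as soon as the averaged means converge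
(`tendsto_integral_abs_empAverage_sub`). For i.i.d. agents these means are constant; for frozen
types they converge almost surely by the strong law applied to functions of the types. -/

/-- Being served earlier is a strict order: the predecessors of `j` are predecessors of `i`, and `j`
precedes `i` but not itself. -/
lemma fcfsRank_lt_fcfsRank {n : ℕ} {y : ℝ} {x : Fin n → ℝ} {i j : Fin n}
    (h : |x j - y| < |x i - y| ∨ (|x j - y| = |x i - y| ∧ j < i)) :
    fcfsRank y x j < fcfsRank y x i := by
  refine Finset.card_lt_card (Finset.ssubset_iff_subset_ne.2 ⟨?_, ?_⟩)
  · intro l hl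
    simp only [Finset.mem_filter, Finset.mem_univ, true_and] at hl ⊢
    rcases h with h | ⟨h, h'⟩ <;> rcases hl with hl | ⟨hl, hl'⟩
    · exact .inl (hl.trans h)
    · exact .inl (hl ▸ h)
    · exact .inl (h ▸ hl)
    · exact .inr ⟨hl.trans h, hl'.trans h'⟩
  · intro he
    have : j ∈ Finset.univ.filter fun l : Fin n =>
        |x l - y| < |x i - y| ∨ (|x l - y| = |x i - y| ∧ l < i) := by simpa using h
    rw [← he] at this
    simp at this

lemma fcfsRank_injective {n : ℕ} (y : ℝ) (x : Fin n → ℝ) :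
    Function.Injective (fcfsRank y x) := by
  intro i j hij
  by_contra hne
  have : (|x j - y| < |x i - y| ∨ (|x j - y| = |x i - y| ∧ j < i)) ∨
      (|x i - y| < |x j - y| ∨ (|x i - y| = |x j - y| ∧ i < j)) := by
    rcases lt_trichotomy |x i - y| |x j - y| with h | h | h
    · exact .inr (.inl h)
    · rcases lt_or_gt_of_ne hne with h' | h'
      · exact .inr (.inr ⟨h, h'⟩)
      · exact .inl (.inr ⟨h.symm, h'⟩)
    · exact .inl (.inl h)
  rcases this with h | h
  · exact (fcfsRank_lt_fcfsRank h).ne' hij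
  · exact (fcfsRank_lt_fcfsRank h).ne hij

lemma fcfsRank_lt {n : ℕ} (y : ℝ) (x : Fin n → ℝ) (i : Fin n) : fcfsRank y x i < n := by
  calc fcfsRank y x i < (Finset.univ : Finset (Fin n)).card := by
        refine Finset.card_lt_card (Finset.filter_ssubset.2 ⟨i, Finset.mem_univ i, ?_⟩)
        simp
    _ = n := by simp

/-- The agents of rank smaller than `k`. -/
noncomputable def accommodated {n : ℕ} (y : ℝ) (x : Fin n → ℝ) (k : ℕ) : Finset (Fin n) :=
  Finset.univ.filter fun i => fcfsRank y x i < k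

/-- The rank is injective with values below `n`, hence a bijection onto `Finset.range n`. -/
lemma card_accommodated {n : ℕ} (y : ℝ) (x : Fin n → ℝ) {k : ℕ} (hk : k ≤ n) :
    (accommodated y x k).card = k := by
  have himg : (Finset.univ : Finset (Fin n)).image (fcfsRank y x) = Finset.range n := by
    refine Finset.eq_of_subset_of_card_le ?_ ?_
    · intro r hr
      obtain ⟨i, -, rfl⟩ := Finset.mem_image.1 hr
      exact Finset.mem_range.2 (fcfsRank_lt y x i)
    · rw [Finset.card_image_of_injective _ (fcfsRank_injective y x)]; simp
  rw [← Finset.card_image_of_injective _ (fcfsRank_injective y x)]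
  have : (accommodated y x k).image (fcfsRank y x) = Finset.range k := by
    ext r
    simp only [accommodated, Finset.mem_image, Finset.mem_filter, Finset.mem_univ, true_and,
      Finset.mem_range]
    constructor
    · rintro ⟨i, hi, rfl⟩; exact hi
    · intro hr
      have : r ∈ Finset.range n := Finset.mem_range.2 (hr.trans_le hk)
      rw [← himg] at this
      obtain ⟨i, -, rfl⟩ := Finset.mem_image.1 this
      exact ⟨i, hr, rfl⟩
  rw [this, Finset.card_range]

lemma abs_sub_le_of_mem_accommodated {n : ℕ} {y : ℝ} {x : Fin n → ℝ} {k : ℕ} {i j : Fin n}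
    (hi : i ∈ accommodated y x k) (hj : j ∉ accommodated y x k) : |x i - y| ≤ |x j - y| := by
  simp only [accommodated, Finset.mem_filter, Finset.mem_univ, true_and, not_lt] at hi hj
  by_contra! h
  exact absurd (fcfsRank_lt_fcfsRank (.inl h)) (by omega)

/-- If some accommodated agent is farther than `t`, all agents within distance `t` are
accommodated. -/
lemma card_accommodated_far_le {n : ℕ} (y t : ℝ) (x : Fin n → ℝ) {k : ℕ} (hk : k ≤ n) :
    (((accommodated y x k).filter fun i => t < |x i - y|).card : ℝ) ≤
      max ((k : ℝ) - (Finset.univ.filter fun i => |x i - y| ≤ t).card) 0 := by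
  set A := accommodated y x k with hA
  rcases (A.filter fun i => t < |x i - y|).eq_empty_or_nonempty with h | ⟨i, hi⟩
  · simp [h]
  · refine le_max_of_le_left ?_
    rw [Finset.mem_filter] at hi
    have hsub : (Finset.univ.filter fun i => |x i - y| ≤ t) = A.filter fun i => ¬ t < |x i - y| := by
      ext j
      simp only [Finset.mem_filter, Finset.mem_univ, true_and, not_lt]
      refine ⟨fun hj => ⟨?_, hj⟩, fun hj => hj.2⟩
      by_contra hjA
      have := abs_sub_le_of_mem_accommodated hi.1 hjA
      linarith [hi.2]
    have := Finset.card_filter_add_card_filter_not (s := A) (fun i => t < |x i - y|)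
    rw [← hsub, hA, card_accommodated y x hk] at this
    rw [hA, le_sub_iff_add_le]
    exact_mod_cast this.le

/-- Mirror image of `card_accommodated_far_le`: one excluded agent closer than `t` forces all
accommodated agents to be closer than `t`, so the count is an exact difference; otherwise it is
zero. -/
lemma card_not_accommodated_near_le {n : ℕ} (y t : ℝ) (x : Fin n → ℝ) {k : ℕ} (hk : k ≤ n) :
    (((accommodated y x k)ᶜ.filter fun i => |x i - y| < t).card : ℝ) ≤
      max (((Finset.univ.filter fun i => |x i - y| < t).card : ℝ) - k) 0 := by
  set A := accommodated y x k with hA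
  rcases (Aᶜ.filter fun i => |x i - y| < t).eq_empty_or_nonempty with h | ⟨i, hi⟩
  · simp [h]
  · refine le_max_of_le_left ?_
    rw [Finset.mem_filter, Finset.mem_compl] at hi
    have hsub : A ⊆ Finset.univ.filter fun i => |x i - y| < t := by
      intro j hj
      simp only [Finset.mem_filter, Finset.mem_univ, true_and]
      exact (abs_sub_le_of_mem_accommodated hj hi.1).trans_lt hi.2
    have heq : (Aᶜ.filter fun i => |x i - y| < t) =
        (Finset.univ.filter fun i => |x i - y| < t) \ A := by
      ext j; simp [and_comm]
    have := Finset.card_sdiff_add_card_eq_card hsub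
    rw [← heq, hA, card_accommodated y x hk] at this
    rw [hA, le_sub_iff_add_le]
    exact_mod_cast this.le

/-- The sum of the `k` smallest distances, compared with its dual value at the threshold `t`. -/
lemma abs_sum_accommodated_sub_le {n : ℕ} (y t M : ℝ) (x : Fin n → ℝ) {k : ℕ} (hk : k ≤ n)
    (hM : ∀ i, |(|x i - y| - t)| ≤ M) :
    |∑ i ∈ accommodated y x k, |x i - y| - (k * t - ∑ i, max (t - |x i - y|) 0)| ≤
      M * (max ((k : ℝ) - (Finset.univ.filter fun i => |x i - y| ≤ t).card) 0 +
        max (((Finset.univ.filter fun i => |x i - y| < t).card : ℝ) - k) 0) := by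
  set A := accommodated y x k with hA
  have hcard : (k : ℝ) * t = ∑ i ∈ A, t := by
    rw [Finset.sum_const, hA, card_accommodated y x hk, nsmul_eq_mul]
  have hsplit : ∑ i, max (t - |x i - y|) 0 =
      ∑ i ∈ A, max (t - |x i - y|) 0 + ∑ i ∈ Aᶜ, max (t - |x i - y|) 0 :=
    (Finset.sum_add_sum_compl A _).symm
  -- The duality gap is exact: only accommodated agents beyond `t` and excluded agents within `t`
  -- contribute.
  have herr : ∑ i ∈ A, |x i - y| - (k * t - ∑ i, max (t - |x i - y|) 0) =
      ∑ i ∈ A, max (|x i - y| - t) 0 + ∑ i ∈ Aᶜ, max (t - |x i - y|) 0 := by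
    rw [hcard, hsplit, sub_sub_eq_add_sub, ← add_assoc, ← Finset.sum_add_distrib,
      add_sub_right_comm, ← Finset.sum_sub_distrib]
    congr 1
    refine Finset.sum_congr rfl fun i _ => ?_
    rcases le_total t |x i - y| with h | h
    · rw [max_eq_right (by linarith), max_eq_left (by linarith)]; ring
    · rw [max_eq_left (by linarith), max_eq_right (by linarith)]; ring
  have h1 : ∑ i ∈ A, max (|x i - y| - t) 0 ≤
      M * ((A.filter fun i => t < |x i - y|).card : ℝ) := by
    rw [mul_comm, ← nsmul_eq_mul, ← Finset.sum_const, Finset.sum_filter]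
    refine Finset.sum_le_sum fun i _ => ?_
    split_ifs with h
    · exact max_le ((le_abs_self _).trans (hM i)) ((abs_nonneg _).trans (hM i))
    · exact max_le (by linarith) le_rfl
  have h2 : ∑ i ∈ Aᶜ, max (t - |x i - y|) 0 ≤
      M * ((Aᶜ.filter fun i => |x i - y| < t).card : ℝ) := by
    rw [mul_comm, ← nsmul_eq_mul, ← Finset.sum_const, Finset.sum_filter]
    refine Finset.sum_le_sum fun i _ => ?_
    split_ifs with h
    · refine max_le ?_ ((abs_nonneg _).trans (hM i))
      linarith [neg_abs_le (|x i - y| - t), hM i]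
    · exact max_le (by linarith) le_rfl
  rw [herr, abs_of_nonneg (add_nonneg (Finset.sum_nonneg fun _ _ => le_max_right _ _)
    (Finset.sum_nonneg fun _ _ => le_max_right _ _))]
  -- For `n = 0` the hypothesis `hM` is vacuous and `M` may be negative, but both sides vanish.
  rcases Nat.eq_zero_or_pos n with rfl | hn
  · have : A = ∅ := Finset.eq_empty_of_isEmpty _
    simp only [this, Finset.sum_empty, Finset.univ_eq_empty, Finset.compl_empty]
    obtain rfl : k = 0 := by omega
    simp
  · have hM0 : 0 ≤ M := (abs_nonneg _).trans (hM ⟨0, hn⟩)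
    rw [mul_add]
    exact add_le_add
      (h1.trans (mul_le_mul_of_nonneg_left (card_accommodated_far_le y t x hk) hM0))
      (h2.trans (mul_le_mul_of_nonneg_left (card_not_accommodated_near_le y t x hk) hM0))

lemma socialWelfare_eq {n : ℕ} (q y : ℝ) (x : Fin n → ℝ) (hk : ⌊q * (n : ℝ)⌋₊ ≤ n) :
    socialWelfare q y x = (⌊q * (n : ℝ)⌋₊ : ℝ) / n -
      (∑ i ∈ accommodated y x ⌊q * (n : ℝ)⌋₊, |x i - y|) / n := by
  have : ∑ i, agentUtility q y x i =
      ∑ i ∈ accommodated y x ⌊q * (n : ℝ)⌋₊, (1 - |x i - y|) := by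
    rw [accommodated, Finset.sum_filter]; rfl
  rw [socialWelfare, this, Finset.sum_sub_distrib, Finset.sum_const, card_accommodated y x hk,
    nsmul_eq_mul]
  ring

/-- The average of `f` over the agents' positions. -/
noncomputable def empAverage {n : ℕ} (f : ℝ → ℝ) (x : Fin n → ℝ) : ℝ := (∑ i, f (x i)) / n

/-- Deterministic estimate of the welfare by three empirical averages. -/
lemma abs_socialWelfare_sub_le {n : ℕ} (hn : 0 < n) {q : ℝ} (hq1 : q ≤ 1)
    (y : ℝ) {t : ℝ} (ht : 0 ≤ t) (M : ℝ) (x : Fin n → ℝ)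
    (hM : ∀ i, |(|x i - y| - t)| ≤ M) {a b : ℝ} (ha : a ≤ q) (hb : q ≤ b) (g : ℝ) :
    |socialWelfare q y x - (q - (q * t - g))| ≤
      (1 + t + 2 * M) * |(⌊q * (n : ℝ)⌋₊ : ℝ) / n - q| +
      |empAverage (fun z => max (t - |z - y|) 0) x - g| +
      M * (|empAverage (Set.indicator {z | |z - y| ≤ t} 1) x - b| +
        |empAverage (Set.indicator {z | |z - y| < t} 1) x - a|) := by
  have hn' : (0 : ℝ) < n := by exact_mod_cast hn
  have hM0 : 0 ≤ M := (abs_nonneg _).trans (hM ⟨0, hn⟩)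
  have hk : ⌊q * (n : ℝ)⌋₊ ≤ n := by
    refine Nat.floor_le_of_le ?_
    nlinarith
  rw [socialWelfare_eq q y x hk]
  have key := abs_sum_accommodated_sub_le y t M x hk hM
  set k := ⌊q * (n : ℝ)⌋₊
  set S := ∑ i ∈ accommodated y x k, |x i - y|
  have hF : empAverage (Set.indicator {z | |z - y| ≤ t} 1) x =
      ((Finset.univ.filter fun i => |x i - y| ≤ t).card : ℝ) / n := by
    simp [empAverage, Set.indicator_apply]
  have hF' : empAverage (Set.indicator {z | |z - y| < t} 1) x =
      ((Finset.univ.filter fun i => |x i - y| < t).card : ℝ) / n := by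
    simp [empAverage, Set.indicator_apply]
  set F := empAverage (Set.indicator {z | |z - y| ≤ t} 1) x
  set F' := empAverage (Set.indicator {z | |z - y| < t} 1) x
  set G := empAverage (fun z => max (t - |z - y|) 0) x with hG
  have key' : |S / n - (k / n * t - G)| ≤ M * (max ((k : ℝ) / n - F) 0 + max (F' - k / n) 0) := by
    rw [hF, hF', ← sub_div, ← sub_div, ← zero_div (n : ℝ), max_div_div_right hn'.le,
      max_div_div_right hn'.le, ← add_div, ← mul_div_assoc, le_div_iff₀ hn']
    refine le_trans (le_of_eq ?_) key
    have hscale : S - (k * t - ∑ i, max (t - |x i - y|) 0) = (S / n - (k / n * t - G)) * n := by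
      rw [hG, empAverage]
      field_simp
    rw [hscale, abs_mul, abs_of_pos hn']
  -- Inserting `q ≤ b` here, and `a ≤ q` below, turns the one-sided excesses into deviations of the
  -- ball frequencies from `b` and `a`.
  have e1 : max ((k : ℝ) / n - F) 0 ≤ |(k : ℝ) / n - q| + |F - b| :=
    max_le (by linarith [le_abs_self ((k : ℝ) / n - q), neg_abs_le (F - b)]) (by positivity)
  have e2 : max (F' - (k : ℝ) / n) 0 ≤ |(k : ℝ) / n - q| + |F' - a| :=
    max_le (by linarith [neg_abs_le ((k : ℝ) / n - q), le_abs_self (F' - a)]) (by positivity)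
  -- The rounding error enters with weight `1` through `k / n` and `t` through `k / n * t`; `e1` and
  -- `e2` add `2 * M`.
  have e3 : |(k : ℝ) / n - S / n - (q - (q * t - g))| ≤
      |(k : ℝ) / n - q| + |S / n - (k / n * t - G)| + t * |(k : ℝ) / n - q| + |G - g| := by
    have : (k : ℝ) / n - S / n - (q - (q * t - g)) =
      ((k : ℝ) / n - q) + (-(S / n - (k / n * t - G))) + (-(t * ((k : ℝ) / n - q))) + (G - g) := by
      ring
    rw [this]
    refine (abs_add_le _ _).trans (add_le_add_left ((abs_add_le _ _).trans ?_) _)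
    rw [abs_neg, abs_mul, abs_of_nonneg ht]
    refine (add_le_add_left ((abs_add_le _ _).trans ?_) _)
    rw [abs_neg]
  have e4 := key'.trans (mul_le_mul_of_nonneg_left (add_le_add e1 e2) hM0)
  linarith

/-! ### The unbalanced distance to a multiple of a Dirac mass -/

lemma ofReal_integral_le_lintegral_ofReal {α : Type*} [MeasurableSpace α] {μ : Measure α}
    {g : α → ℝ} (hg : Integrable g μ) :
    ENNReal.ofReal (∫ x, g x ∂μ) ≤ ∫⁻ x, ENNReal.ofReal (g x) ∂μ := by
  calc ENNReal.ofReal (∫ x, g x ∂μ) ≤ ENNReal.ofReal (∫ x, max (g x) 0 ∂μ) :=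
        ENNReal.ofReal_le_ofReal (integral_mono hg hg.pos_part fun x => le_max_left _ _)
    _ = ∫⁻ x, ENNReal.ofReal (max (g x) 0) ∂μ :=
        ofReal_integral_eq_lintegral_ofReal hg.pos_part (ae_of_all _ fun x => le_max_right _ _)
    _ = ∫⁻ x, ENNReal.ofReal (g x) ∂μ := by simp [ENNReal.ofReal_max]

lemma measurable_posPart_sub_dist (y t : ℝ) : Measurable fun z : ℝ => max (t - |z - y|) 0 := by
  fun_prop

lemma posPart_sub_dist_mem {y t : ℝ} (ht : 0 ≤ t) (z : ℝ) :
    max (t - |z - y|) 0 ∈ Set.Icc 0 t :=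
  ⟨le_max_right _ _, max_le (by linarith [abs_nonneg (z - y)]) ht⟩

lemma indicator_one_mem_Icc (s : Set ℝ) (z : ℝ) :
    Set.indicator s (1 : ℝ → ℝ) z ∈ Set.Icc (0 : ℝ) 1 :=
  ⟨Set.indicator_nonneg (fun _ _ => zero_le_one) z,
    Set.indicator_le_self' (fun _ _ => zero_le_one) z⟩

lemma integrable_of_mem_Icc {α : Type*} [MeasurableSpace α] {μ : Measure α} [IsFiniteMeasure μ]
    {f : α → ℝ} (hf : AEMeasurable f μ) {a b : ℝ} (h : ∀ x, f x ∈ Set.Icc a b) :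
    Integrable f μ :=
  Integrable.of_mem_Icc a b hf (ae_of_all _ h)

/-- Weak duality: every transportation plan costs at least the dual value at `t`. -/
lemma le_wassersteinOne_smul_dirac (μ : Measure ℝ) {q y t : ℝ} (ht : 0 ≤ t) :
    ENNReal.ofReal (q * t - ∫ z, max (t - |z - y|) 0 ∂μ) ≤
      wassersteinOne μ (ENNReal.ofReal q • Measure.dirac y) := by
  refine le_iInf₂ fun π hπ => ?_
  obtain ⟨hπ, hfst, hsnd⟩ := hπ
  set E : Set (ℝ × ℝ) := Prod.snd ⁻¹' {y}
  have hE : MeasurableSet E := measurable_snd (measurableSet_singleton y)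
  have hqE : q ≤ π.real E := by
    have := hsnd {y}
    rw [Measure.snd_apply (measurableSet_singleton y)] at this
    rw [Measure.real, ← ENNReal.ofReal_le_iff_le_toReal (measure_ne_top _ _)]
    simpa using this
  have i1 : Integrable (E.indicator fun _ => t) π := (integrable_const t).indicator hE
  have i2 : Integrable (fun p : ℝ × ℝ => max (t - |p.1 - y|) 0) π :=
    integrable_of_mem_Icc (by fun_prop) fun p => posPart_sub_dist_mem ht p.1
  have hint : ∫ p, (E.indicator (fun _ => t) p - max (t - |p.1 - y|) 0) ∂π =
      π.real E * t - ∫ z, max (t - |z - y|) 0 ∂μ := by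
    rw [integral_sub i1 i2, integral_indicator_const _ hE, smul_eq_mul, ← hfst, Measure.fst,
      integral_map measurable_fst.aemeasurable
        (measurable_posPart_sub_dist y t).aestronglyMeasurable]
  calc _ ≤ ENNReal.ofReal (∫ p, (E.indicator (fun _ => t) p - max (t - |p.1 - y|) 0) ∂π) := by
        rw [hint]
        exact ENNReal.ofReal_le_ofReal (by nlinarith)
    _ ≤ ∫⁻ p, ENNReal.ofReal (E.indicator (fun _ => t) p - max (t - |p.1 - y|) 0) ∂π :=
        ofReal_integral_le_lintegral_ofReal (i1.sub i2)
    -- Dual feasibility: the integrand is at most `|p.1 - p.2|` pointwise, by `t - max (t - d) 0 ≤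
    -- d` when `p.2 = y` and by sign otherwise.
    _ ≤ _ := by
        refine lintegral_mono fun p => ENNReal.ofReal_le_ofReal ?_
        by_cases hp : p ∈ E
        · have : p.2 = y := hp
          rw [Set.indicator_of_mem hp, this]
          linarith [le_max_left (t - |p.1 - y|) 0]
        · rw [Set.indicator_of_notMem hp]
          linarith [le_max_right (t - |p.1 - y|) 0, abs_nonneg (p.1 - p.2)]

/-- Sending the part `f` of the mass to `y` and leaving the rest in place. -/
lemma wassersteinOne_smul_dirac_le (μ : Measure ℝ) [IsProbabilityMeasure μ] {y : ℝ} {f : ℝ → ℝ}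
    (hf : Measurable f) (hf01 : ∀ z, f z ∈ Set.Icc (0 : ℝ) 1) :
    wassersteinOne μ (ENNReal.ofReal (∫ z, f z ∂μ) • Measure.dirac y) ≤
      ∫⁻ z, ENNReal.ofReal (f z * |z - y|) ∂μ := by
  set u : ℝ → ℝ≥0∞ := fun z => ENNReal.ofReal (f z)
  set v : ℝ → ℝ≥0∞ := fun z => ENNReal.ofReal (1 - f z)
  have hu : Measurable u := hf.ennreal_ofReal
  have hv : Measurable v := (measurable_const.sub hf).ennreal_ofReal
  have huv : u + v = 1 := by
    ext z
    simp only [u, v, Pi.add_apply, Pi.one_apply]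
    rw [← ENNReal.ofReal_add (hf01 z).1 (by linarith [(hf01 z).2])]
    simp
  have hμ : μ.withDensity u + μ.withDensity v = μ := by
    rw [← withDensity_add_left hu, huv, withDensity_one]
  have m1 : Measurable fun z : ℝ => (z, y) := by fun_prop
  have m2 : Measurable fun z : ℝ => (z, z) := by fun_prop
  set π : Measure (ℝ × ℝ) := (μ.withDensity u).map (fun z => (z, y)) +
    (μ.withDensity v).map (fun z => (z, z)) with hπ
  have hfst : π.fst = μ := by
    rw [hπ, Measure.fst_add, Measure.fst, Measure.fst, Measure.map_map measurable_fst m1,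
      Measure.map_map measurable_fst m2]
    exact (congrArg₂ (· + ·) Measure.map_id Measure.map_id).trans hμ
  have hsnd : ENNReal.ofReal (∫ z, f z ∂μ) • Measure.dirac y ≤ π.snd := by
    rw [hπ, Measure.snd_add, Measure.snd, Measure.map_map measurable_snd m1]
    refine le_trans (le_of_eq ?_) (Measure.le_add_right le_rfl)
    change _ = Measure.map (fun _ => y) _
    rw [Measure.map_const, withDensity_apply _ MeasurableSet.univ, Measure.restrict_univ,
      ofReal_integral_eq_lintegral_ofReal (integrable_of_mem_Icc hf.aemeasurable hf01)
        (ae_of_all _ fun z => (hf01 z).1)]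
  have hprob : IsProbabilityMeasure π := by
    constructor
    rw [← Measure.fst_univ, hfst, measure_univ]
  refine (iInf₂_le π ⟨hprob, hfst, hsnd⟩).trans (le_of_eq ?_)
  have mc : Measurable fun p : ℝ × ℝ => ENNReal.ofReal |p.1 - p.2| := by fun_prop
  rw [hπ, lintegral_add_measure, lintegral_map mc m1, lintegral_map mc m2,
    lintegral_withDensity_eq_lintegral_mul _ hu (by fun_prop)]
  simp only [sub_self, abs_zero, ENNReal.ofReal_zero, lintegral_zero, add_zero, Pi.mul_apply, u]
  exact lintegral_congr fun z => (ENNReal.ofReal_mul (hf01 z).1).symm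

/-- The distance from `μ` to `q δ_y` is the dual value at a `q`-quantile of the distance to `y`. -/
lemma wassersteinOne_smul_dirac (μ : Measure ℝ) [IsProbabilityMeasure μ] {q y t : ℝ}
    (ht : 0 ≤ t) (hlt : μ.real {z | |z - y| < t} ≤ q)
    (hle : q ≤ μ.real {z | |z - y| ≤ t}) :
    0 ≤ q * t - ∫ z, max (t - |z - y|) 0 ∂μ ∧
    wassersteinOne μ (ENNReal.ofReal q • Measure.dirac y) =
      ENNReal.ofReal (q * t - ∫ z, max (t - |z - y|) 0 ∂μ) := by
  have sL : MeasurableSet {z : ℝ | |z - y| < t} := measurableSet_lt (by fun_prop) (by fun_prop)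
  have sE : MeasurableSet {z : ℝ | |z - y| = t} := measurableSet_eq_fun (by fun_prop) (by fun_prop)
  set a := μ.real {z | |z - y| < t}
  set m := μ.real {z | |z - y| = t}
  have ham : μ.real {z | |z - y| ≤ t} = a + m := by
    rw [← measureReal_union _ sE]
    · congr 1; ext z; exact le_iff_lt_or_eq (a := |z - y|) (b := t)
    · exact Set.disjoint_left.2 fun z (h : |z - y| < t) (h' : |z - y| = t) => h.ne h'
  rw [ham] at hle
  have hm0 : 0 ≤ m := measureReal_nonneg
  -- The optimal plan moves the whole open ball and the fraction `c` of the sphere, so as to reach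
  -- mass exactly `q`. If `m = 0`, then `q = a` and the default value `c = 0` is right.
  set c := (q - a) / m
  have hc : c ∈ Set.Icc (0 : ℝ) 1 :=
    ⟨div_nonneg (by linarith) hm0, div_le_one_of_le₀ (by linarith) hm0⟩
  have hcm : m * c = q - a := by
    rcases hm0.eq_or_lt with h | h
    · rw [← h, zero_mul]; linarith
    · exact mul_div_cancel₀ _ h.ne'
  set f : ℝ → ℝ := fun z => Set.indicator {z | |z - y| < t} (fun _ => (1 : ℝ)) z +
    Set.indicator {z | |z - y| = t} (fun _ => c) z
  have hf : Measurable f :=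
    (measurable_const.indicator sL).add (measurable_const.indicator sE)
  -- The identity is complementary slackness: `f` is `1` inside the ball, `0` outside, and `t - |z -
  -- y|` vanishes on the sphere.
  have hfval : ∀ z, f z ∈ Set.Icc (0 : ℝ) 1 ∧ f z * |z - y| = f z * t - max (t - |z - y|) 0 := by
    intro z
    simp only [f, Set.indicator_apply, Set.mem_ofPred_eq]
    rcases lt_trichotomy |z - y| t with h | h | h
    · simp only [h, h.ne, if_true, if_false]
      rw [max_eq_left (by linarith)]
      exact ⟨by norm_num, by ring⟩
    · simp [h, hc.1, hc.2]
    · simp [h.not_gt, h.ne', h.le]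
  have hfi : ∫ z, f z ∂μ = q := by
    rw [integral_add ((integrable_const _).indicator sL) ((integrable_const _).indicator sE),
      integral_indicator_const _ sL, integral_indicator_const _ sE, smul_eq_mul, smul_eq_mul, hcm]
    ring
  have if1 : Integrable f μ := integrable_of_mem_Icc hf.aemeasurable fun z => (hfval z).1
  have ig : Integrable (fun z => max (t - |z - y|) 0) μ :=
    integrable_of_mem_Icc (measurable_posPart_sub_dist y t).aemeasurable
      fun z => posPart_sub_dist_mem ht z
  have hval : ∫ z, f z * |z - y| ∂μ = q * t - ∫ z, max (t - |z - y|) 0 ∂μ := by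
    rw [integral_congr_ae (ae_of_all _ fun z => (hfval z).2), integral_sub (if1.mul_const t) ig,
      integral_mul_const, hfi]
  have hnn : ∀ z, 0 ≤ f z * |z - y| := fun z => mul_nonneg (hfval z).1.1 (abs_nonneg _)
  refine ⟨hval ▸ integral_nonneg hnn, le_antisymm ?_ (le_wassersteinOne_smul_dirac μ ht)⟩
  have := wassersteinOne_smul_dirac_le μ (y := y) hf fun z => (hfval z).1
  rw [hfi] at this
  refine this.trans (le_of_eq ?_)
  rw [← hval]
  refine (ofReal_integral_eq_lintegral_ofReal ?_ (ae_of_all _ hnn)).symm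
  refine ((if1.mul_const t).sub ig).congr (ae_of_all _ fun z => ?_)
  exact (hfval z).2.symm

/-- Existence of quantiles of a bounded nonnegative law. -/
lemma exists_quantile (ν : Measure ℝ) [IsProbabilityMeasure ν] {q M : ℝ} (hq0 : 0 ≤ q)
    (hq1 : q ≤ 1) (h0 : ν (Set.Iio 0) = 0) (hM : ν (Set.Ioi M) = 0) :
    ∃ t, 0 ≤ t ∧ ν.real (Set.Iio t) ≤ q ∧ q ≤ ν.real (Set.Iic t) := by
  -- For `q = 0` the set `S` below would be the whole line, without an infimum.
  rcases hq0.eq_or_lt with rfl | hq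
  · exact ⟨0, le_rfl, by simp [Measure.real, h0], measureReal_nonneg⟩
  have hMS : cdf ν M = 1 := by
    rw [cdf_eq_real, Measure.real, (prob_compl_eq_zero_iff measurableSet_Iic).1 (by simpa using hM),
      ENNReal.toReal_one]
  set S : Set ℝ := {s | q ≤ cdf ν s}
  have hne : S.Nonempty := ⟨M, by simp [S, hMS, hq1]⟩
  have hS0 : ∀ s ∈ S, 0 ≤ s := by
    intro s hs
    by_contra! hs0
    have : ν.real (Set.Iic s) = 0 := by
      rw [measureReal_eq_zero_iff]
      exact measure_mono_null (fun z hz => lt_of_le_of_lt hz hs0) h0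
    have hs' : q ≤ cdf ν s := hs
    rw [cdf_eq_real, this] at hs'
    linarith
  have hbdd : BddBelow S := ⟨0, hS0⟩
  refine ⟨sInf S, le_csInf hne hS0, ?_, ?_⟩
  · have h1 : ν (Set.Iio (sInf S)) = ENNReal.ofReal (Function.leftLim (cdf ν) (sInf S)) := by
      conv_lhs => rw [← measure_cdf ν]
      rw [StieltjesFunction.measure_Iio _ (tendsto_cdf_atBot ν), sub_zero]
    have h2 : Function.leftLim (cdf ν) (sInf S) ≤ q := by
      refine le_of_tendsto ((monotone_cdf ν).tendsto_leftLim _) ?_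
      filter_upwards [self_mem_nhdsWithin] with s hs
      by_contra! h
      exact absurd (csInf_le hbdd (show s ∈ S from h.le)) (not_le.2 hs)
    rw [Measure.real, h1]
    exact ENNReal.toReal_le_of_le_ofReal hq0 (ENNReal.ofReal_le_ofReal h2)
  · rw [← cdf_eq_real]
    have hc := ((cdf ν).right_continuous (sInf S)).mono Set.Ioi_subset_Ici_self
    refine ge_of_tendsto (x := 𝓝[>] (sInf S)) hc ?_
    filter_upwards [self_mem_nhdsWithin] with s hs
    obtain ⟨r, hr, hrs⟩ := exists_lt_of_csInf_lt hne hs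
    exact le_trans hr (monotone_cdf ν hrs.le)

/-! ### Measurability and integrability of the welfare -/

lemma measurable_fcfsRank {n : ℕ} (y : ℝ) (i : Fin n) :
    Measurable fun x : Fin n → ℝ => fcfsRank y x i := by
  simp only [fcfsRank, Finset.card_filter]
  refine Finset.measurable_fun_sum _ fun j _ => Measurable.ite ?_ measurable_const measurable_const
  have hd : ∀ l : Fin n, Measurable fun x : Fin n → ℝ => |x l - y| := fun l => by fun_prop
  exact (measurableSet_lt (hd j) (hd i)).union
    ((measurableSet_eq_fun (hd j) (hd i)).inter (MeasurableSet.const _))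

lemma measurable_socialWelfare (n : ℕ) (q y : ℝ) :
    Measurable fun x : Fin n → ℝ => socialWelfare q y x := by
  refine (Finset.measurable_fun_sum _ fun i _ => ?_).const_mul _
  refine Measurable.ite ?_ (by fun_prop) measurable_const
  exact measurable_fcfsRank y i (measurableSet_Iio (a := ⌊q * (n : ℝ)⌋₊))

lemma abs_socialWelfare_le {n : ℕ} (q y : ℝ) {x : Fin n → ℝ}
    (hx : ∀ i, x i ∈ Set.Icc (0 : ℝ) 1) : |socialWelfare q y x| ≤ 2 + |y| := by
  have hu : ∀ i, |agentUtility q y x i| ≤ 2 + |y| := by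
    intro i
    rw [agentUtility]
    split_ifs
    · have h1 := abs_sub (x i) y
      have h2 := abs_sub 1 |x i - y|
      rw [abs_abs, abs_one] at h2
      have h3 : |x i| ≤ 1 := abs_le.2 ⟨by linarith [(hx i).1], (hx i).2⟩
      linarith
    · rw [abs_zero]; positivity
  rw [socialWelfare, abs_mul, abs_of_nonneg (by positivity)]
  calc 1 / (n : ℝ) * |∑ i, agentUtility q y x i| ≤ 1 / (n : ℝ) * (n * (2 + |y|)) := by
        refine mul_le_mul_of_nonneg_left ?_ (by positivity)
        refine (Finset.abs_sum_le_sum_abs _ _).trans ((Finset.sum_le_sum fun i _ => hu i).trans ?_)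
        rw [Finset.sum_const, Finset.card_univ, Fintype.card_fin, nsmul_eq_mul]
    _ = (n / n : ℝ) * (2 + |y|) := by ring
    _ ≤ 2 + |y| := mul_le_of_le_one_left (by positivity) (div_self_le_one _)

lemma ae_pi_mem_Icc {n : ℕ} (ν : Fin n → Measure ℝ) [∀ i, IsProbabilityMeasure (ν i)]
    (hν : ∀ i, ν i (Set.Icc (0 : ℝ) 1)ᶜ = 0) :
    ∀ᵐ x ∂Measure.pi ν, ∀ i, x i ∈ Set.Icc (0 : ℝ) 1 := by
  refine ae_all_iff.2 fun i => ?_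
  have : ∀ᵐ z ∂ν i, z ∈ Set.Icc (0 : ℝ) 1 := mem_ae_iff.2 (hν i)
  exact (measurePreserving_eval ν i).quasiMeasurePreserving.ae this

lemma integrable_socialWelfare_pi {n : ℕ} (q y : ℝ) (ν : Fin n → Measure ℝ)
    [∀ i, IsProbabilityMeasure (ν i)] (hν : ∀ i, ν i (Set.Icc (0 : ℝ) 1)ᶜ = 0) :
    Integrable (fun x : Fin n → ℝ => socialWelfare q y x) (Measure.pi ν) := by
  refine Integrable.of_bound (measurable_socialWelfare n q y).aestronglyMeasurable (2 + |y|) ?_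
  filter_upwards [ae_pi_mem_Icc ν hν] with x hx
  exact abs_socialWelfare_le q y hx

/-! ### A law of large numbers for products of different laws -/

/-- The variance of `|Z|` is nonnegative, so the squared first absolute moment is at most the second
moment. -/
lemma integral_abs_sq_le {α : Type*} [MeasurableSpace α] {μ : Measure α} [IsProbabilityMeasure μ]
    {Z : α → ℝ} (hZ : MemLp Z 2 μ) :
    (∫ x, |Z x| ∂μ) ^ 2 ≤ Var[Z; μ] + (∫ x, Z x ∂μ) ^ 2 := by
  have h1 := variance_nonneg (fun x => |Z x|) μ
  have hZ' : MemLp (fun x => |Z x|) 2 μ := hZ.abs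
  rw [variance_eq_sub hZ'] at h1
  have h2 := variance_eq_sub hZ
  have h3 : ∫ x, ((fun x => |Z x|) ^ 2) x ∂μ = ∫ x, (Z ^ 2) x ∂μ := by simp
  rw [h3] at h1
  linarith

lemma memLp_empAverage {n : ℕ} (μ : Measure (Fin n → ℝ)) [IsFiniteMeasure μ] {f : ℝ → ℝ}
    (hf : Measurable f) {B : ℝ} (hB : ∀ z, f z ∈ Set.Icc 0 B) :
    MemLp (fun x : Fin n → ℝ => empAverage f x) 2 μ := by
  have : ∀ i : Fin n, MemLp (fun x : Fin n → ℝ => f (x i)) 2 μ := fun i =>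
    memLp_of_bounded (ae_of_all _ fun x : Fin n → ℝ => hB (x i))
      (hf.comp (measurable_pi_apply i)).aestronglyMeasurable 2
  have h := (memLp_finsetSum Finset.univ fun i _ => this i).mul_const (n : ℝ)⁻¹
  simpa only [empAverage, div_eq_mul_inv] using h

/-- Variance plus squared bias: variances add under the product law, and a variable with values in
`[0, B]` has variance at most `(B / 2) ^ 2`. -/
lemma integral_abs_empAverage_sub_sq_le {n : ℕ} (ν : Fin n → Measure ℝ)
    [∀ i, IsProbabilityMeasure (ν i)] {f : ℝ → ℝ} (hf : Measurable f) {B : ℝ}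
    (hB : ∀ z, f z ∈ Set.Icc 0 B) (m : ℝ) :
    (∫ x, |empAverage f x - m| ∂Measure.pi ν) ^ 2 ≤
      (B / 2) ^ 2 / n + ((∑ i, ∫ z, f z ∂ν i) / n - m) ^ 2 := by
  have hA := memLp_empAverage (Measure.pi ν) hf hB
  refine (integral_abs_sq_le (hA.sub (memLp_const m))).trans (add_le_add ?_ (le_of_eq ?_))
  · have hfi : ∀ i, MemLp f 2 (ν i) := fun i =>
      memLp_of_bounded (ae_of_all _ hB) hf.aestronglyMeasurable 2
    have hv : Var[fun x : Fin n → ℝ => empAverage f x; Measure.pi ν] =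
        (∑ i, Var[f; ν i]) * ((n : ℝ)⁻¹) ^ 2 := by
      rw [← variance_sum_pi (X := fun _ => f) hfi, ← variance_mul_const]
      congr 1
      ext x
      simp [empAverage, div_eq_mul_inv]
    change Var[fun x : Fin n → ℝ => empAverage f x - m; Measure.pi ν] ≤ _
    rw [variance_sub_const hA.aestronglyMeasurable, hv]
    have : ∑ i, Var[f; ν i] ≤ n * (B / 2) ^ 2 := by
      refine (Finset.sum_le_sum fun i _ =>
        variance_le_sq_of_bounded (ae_of_all _ hB) hf.aemeasurable).trans ?_
      simp
    refine (mul_le_mul_of_nonneg_right this (by positivity)).trans (le_of_eq ?_)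
    rcases Nat.eq_zero_or_pos n with rfl | hn
    · simp
    · field_simp
  · congr 1
    have hi : ∀ i : Fin n, Integrable (fun x : Fin n → ℝ => f (x i)) (Measure.pi ν) := fun i =>
      integrable_of_mem_Icc (hf.comp (measurable_pi_apply i)).aemeasurable fun x => hB (x i)
    change ∫ x : Fin n → ℝ, (empAverage f x - m) ∂Measure.pi ν = _
    rw [integral_sub (hA.integrable (by norm_num)) (integrable_const m), integral_const,
      probReal_univ, one_smul]
    simp only [empAverage]
    rw [integral_div, integral_finsetSum _ fun i _ => hi i]
    congr 2
    exact Finset.sum_congr rfl fun i _ => integral_comp_eval hf.aestronglyMeasurable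

lemma tendsto_integral_abs_empAverage_sub (ν : ℕ → Measure ℝ) [∀ i, IsProbabilityMeasure (ν i)]
    {f : ℝ → ℝ} (hf : Measurable f) {B : ℝ} (hB : ∀ z, f z ∈ Set.Icc 0 B) {m : ℝ}
    (hm : Tendsto (fun n : ℕ => (∑ i ∈ Finset.range n, ∫ z, f z ∂ν i) / n) atTop (𝓝 m)) :
    Tendsto (fun n : ℕ => ∫ x : Fin n → ℝ, |empAverage f x - m| ∂Measure.pi fun i : Fin n => ν i)
      atTop (𝓝 0) := by
  have hb : Tendsto (fun n : ℕ => √((B / 2) ^ 2 / n +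
      ((∑ i ∈ Finset.range n, ∫ z, f z ∂ν i) / n - m) ^ 2)) atTop (𝓝 0) := by
    have h1 : Tendsto (fun n : ℕ => (B / 2) ^ 2 / (n : ℝ)) atTop (𝓝 0) :=
      tendsto_const_div_atTop_nhds_zero_nat _
    have := (h1.add ((hm.sub_const m).pow 2)).sqrt
    simpa using this
  refine squeeze_zero (fun n => integral_nonneg fun x => abs_nonneg _) (fun n => ?_) hb
  refine Real.le_sqrt_of_sq_le ?_
  have := integral_abs_empAverage_sub_sq_le (fun i : Fin n => ν i) hf hB m
  rwa [Fin.sum_univ_eq_sum_range (fun i => ∫ z, f z ∂ν i) n] at this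

/-! ### Limit of the expected welfare -/

/-- For independent agents whose average laws converge to `μ`, the expected welfare converges to
the value determined by a `q`-quantile `t` of the distance to `y` under `μ`. -/
lemma tendsto_integral_socialWelfare (ν : ℕ → Measure ℝ) [∀ i, IsProbabilityMeasure (ν i)]
    (hν : ∀ i, ν i (Set.Icc (0 : ℝ) 1)ᶜ = 0) (μ : Measure ℝ) {q y t : ℝ}
    (hq0 : 0 ≤ q) (hq1 : q ≤ 1) (ht : 0 ≤ t) (hlt : μ.real {z | |z - y| < t} ≤ q)
    (hle : q ≤ μ.real {z | |z - y| ≤ t})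
    (hG : Tendsto (fun n : ℕ => (∑ i ∈ Finset.range n, ∫ z, max (t - |z - y|) 0 ∂ν i) / n) atTop
      (𝓝 (∫ z, max (t - |z - y|) 0 ∂μ)))
    (hL : Tendsto (fun n : ℕ => (∑ i ∈ Finset.range n,
      ∫ z, Set.indicator {z | |z - y| < t} (1 : ℝ → ℝ) z ∂ν i) / n) atTop
      (𝓝 (∫ z, Set.indicator {z | |z - y| < t} (1 : ℝ → ℝ) z ∂μ)))
    (hF : Tendsto (fun n : ℕ => (∑ i ∈ Finset.range n,
      ∫ z, Set.indicator {z | |z - y| ≤ t} (1 : ℝ → ℝ) z ∂ν i) / n) atTop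
      (𝓝 (∫ z, Set.indicator {z | |z - y| ≤ t} (1 : ℝ → ℝ) z ∂μ))) :
    Tendsto (fun n : ℕ => ∫ x : Fin n → ℝ, socialWelfare q y x ∂Measure.pi fun i : Fin n => ν i)
      atTop (𝓝 (q - (q * t - ∫ z, max (t - |z - y|) 0 ∂μ))) := by
  have sL : MeasurableSet {z : ℝ | |z - y| < t} := measurableSet_lt (by fun_prop) (by fun_prop)
  have sF : MeasurableSet {z : ℝ | |z - y| ≤ t} := measurableSet_le (by fun_prop) (by fun_prop)
  have mG := measurable_posPart_sub_dist y t
  have mL : Measurable (Set.indicator {z | |z - y| < t} (1 : ℝ → ℝ)) := measurable_one.indicator sL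
  have mF : Measurable (Set.indicator {z | |z - y| ≤ t} (1 : ℝ → ℝ)) := measurable_one.indicator sF
  have bG : ∀ z, max (t - |z - y|) 0 ∈ Set.Icc 0 t := posPart_sub_dist_mem ht
  rw [integral_indicator_one sL] at hL
  rw [integral_indicator_one sF] at hF
  have TG := tendsto_integral_abs_empAverage_sub ν mG bG hG
  have TL := tendsto_integral_abs_empAverage_sub ν mL (indicator_one_mem_Icc _) hL
  have TF := tendsto_integral_abs_empAverage_sub ν mF (indicator_one_mem_Icc _) hF
  set g := ∫ z, max (t - |z - y|) 0 ∂μ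
  set a := μ.real {z | |z - y| < t}
  set b := μ.real {z | |z - y| ≤ t}
  -- This bounds `||x - y| - t|` for every position `x` in `[0, 1]`.
  set M := 1 + |y| + t
  have TK : Tendsto (fun n : ℕ => |(⌊q * (n : ℝ)⌋₊ : ℝ) / n - q|) atTop (𝓝 0) := by
    have h := (tendsto_nat_floor_mul_div_atTop hq0).comp (tendsto_natCast_atTop_atTop (R := ℝ))
    have := (h.sub_const q).abs
    simpa using this
  have TB := ((TK.const_mul (1 + t + 2 * M)).add TG).add ((TF.add TL).const_mul M)
  simp only [mul_zero, add_zero] at TB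
  rw [tendsto_iff_norm_sub_tendsto_zero]
  refine squeeze_zero' (Eventually.of_forall fun n => norm_nonneg _) ?_ TB
  filter_upwards [eventually_gt_atTop 0] with n hn
  set π := Measure.pi fun i : Fin n => ν i
  have iW := integrable_socialWelfare_pi q y (fun i : Fin n => ν i) fun i => hν i
  have iA : ∀ {f : ℝ → ℝ} {B : ℝ} (_ : Measurable f) (_ : ∀ z, f z ∈ Set.Icc 0 B) (m : ℝ),
      Integrable (fun x : Fin n → ℝ => |empAverage f x - m|) π := fun hf hB m =>
    (((memLp_empAverage π hf hB).integrable (by norm_num)).sub (integrable_const m)).abs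
  have iG := iA mG bG g
  have iL := iA mL (indicator_one_mem_Icc _) a
  have iF := iA mF (indicator_one_mem_Icc _) b
  have hsub : ∫ x : Fin n → ℝ, socialWelfare q y x ∂π - (q - (q * t - g)) =
      ∫ x : Fin n → ℝ, (socialWelfare q y x - (q - (q * t - g))) ∂π := by
    rw [integral_sub iW (integrable_const _), integral_const, probReal_univ, one_smul]
  rw [hsub]
  refine (norm_integral_le_integral_norm _).trans ?_
  have hbound : ∫ x : Fin n → ℝ, ‖socialWelfare q y x - (q - (q * t - g))‖ ∂π ≤
      ∫ x : Fin n → ℝ, ((1 + t + 2 * M) * |(⌊q * (n : ℝ)⌋₊ : ℝ) / n - q| +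
        |empAverage (fun z => max (t - |z - y|) 0) x - g| +
        M * (|empAverage (Set.indicator {z | |z - y| ≤ t} 1) x - b| +
          |empAverage (Set.indicator {z | |z - y| < t} 1) x - a|)) ∂π := by
    refine integral_mono_ae (iW.sub (integrable_const _)).norm
      (((integrable_const _).add iG).add ((iF.add iL).const_mul M)) ?_
    filter_upwards [ae_pi_mem_Icc (fun i : Fin n => ν i) fun i => hν i] with x hx
    refine abs_socialWelfare_sub_le hn hq1 y ht M x (fun i => ?_) hlt hle g
    have h1 := abs_sub (x i) y
    have h2 := abs_sub |x i - y| t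
    rw [abs_abs, abs_of_nonneg ht] at h2
    have h3 : |x i| ≤ 1 := abs_le.2 ⟨by linarith [(hx i).1], (hx i).2⟩
    linarith
  refine hbound.trans (le_of_eq ?_)
  have iC : Integrable (fun x : Fin n → ℝ => (1 + t + 2 * M) * |(⌊q * (n : ℝ)⌋₊ : ℝ) / n - q| +
      |empAverage (fun z => max (t - |z - y|) 0) x - g|) π := (integrable_const _).add iG
  have iD : Integrable (fun x : Fin n → ℝ =>
      M * (|empAverage (Set.indicator {z | |z - y| ≤ t} 1) x - b| +
        |empAverage (Set.indicator {z | |z - y| < t} 1) x - a|)) π := (iF.add iL).const_mul M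
  rw [integral_add iC iD, integral_add (integrable_const _) iG, integral_const, probReal_univ,
    one_smul, integral_const_mul, integral_add iF iL]

/-! ### Random types -/

lemma bind_compl_Icc {Θ : Type*} [MeasurableSpace Θ] (η : Measure Θ) (κ : Kernel Θ ℝ)
    (hκ : ∀ θ, κ θ (Set.Icc (0 : ℝ) 1)ᶜ = 0) : η.bind κ (Set.Icc (0 : ℝ) 1)ᶜ = 0 := by
  rw [Measure.bind_apply measurableSet_Icc.compl κ.aemeasurable]
  simp [hκ]

/-- The law of the distance to `y` is carried by `[0, 1 + |y|]`, so `exists_quantile` applies to it.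
-/
lemma exists_quantile_dist (μ : Measure ℝ) [IsProbabilityMeasure μ]
    (hμ : μ (Set.Icc (0 : ℝ) 1)ᶜ = 0) {q : ℝ} (hq0 : 0 ≤ q) (hq1 : q ≤ 1) (y : ℝ) :
    ∃ t, 0 ≤ t ∧ μ.real {z | |z - y| < t} ≤ q ∧ q ≤ μ.real {z | |z - y| ≤ t} := by
  have hd : Measurable fun z : ℝ => |z - y| := by fun_prop
  have : IsProbabilityMeasure (μ.map fun z => |z - y|) :=
    Measure.isProbabilityMeasure_map hd.aemeasurable
  obtain ⟨t, ht, h1, h2⟩ := exists_quantile (μ.map fun z => |z - y|) (M := 1 + |y|) hq0 hq1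
    (by
      rw [Measure.map_apply hd measurableSet_Iio]
      refine (congrArg μ (Set.eq_empty_of_forall_notMem fun z (hz : |z - y| < 0) => ?_)).trans
        measure_empty
      exact absurd hz (not_lt.2 (abs_nonneg _)))
    (by
      rw [Measure.map_apply hd measurableSet_Ioi]
      refine measure_mono_null (t := (Set.Icc (0 : ℝ) 1)ᶜ)
        (fun z (hz : 1 + |y| < |z - y|) hz' => ?_) hμ
      have h1 := abs_sub z y
      have h3 : |z| ≤ 1 := abs_le.2 ⟨by linarith [hz'.1], hz'.2⟩
      linarith)
  rw [map_measureReal_apply hd measurableSet_Iio] at h1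
  rw [map_measureReal_apply hd measurableSet_Iic] at h2
  exact ⟨t, ht, h1, h2⟩

section Types

variable {Θ Ω : Type*} [MeasurableSpace Θ] {η : Measure Θ} [IsProbabilityMeasure η]
  {κ : Kernel Θ ℝ} [IsMarkovKernel κ] [MeasurableSpace Ω] {P : Measure Ω}
  {T : ℕ → Ω → Θ} {X : ℕ → Ω → ℝ}

lemma hasLaw_position (hlaw : ∀ i, HasLaw (fun ω => (T i ω, X i ω)) (η ⊗ₘ κ) P) (i : ℕ) :
    HasLaw (X i) (η.bind κ) P where
  aemeasurable := measurable_snd.comp_aemeasurable (hlaw i).aemeasurable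
  map_eq := by
    rw [← Measure.snd_compProd, Measure.snd, ← (hlaw i).map_eq,
      AEMeasurable.map_map_of_aemeasurable measurable_snd.aemeasurable (hlaw i).aemeasurable]
    rfl

variable [IsProbabilityMeasure P]

/-- Strong law of large numbers for the conditional means of a bounded function. -/
lemma ae_tendsto_average_integral_kernel
    (hlaw : ∀ i, HasLaw (fun ω => (T i ω, X i ω)) (η ⊗ₘ κ) P)
    (hindep : iIndepFun (fun i ω => (T i ω, X i ω)) P)
    {f : ℝ → ℝ} (hf : Measurable f) {B : ℝ} (hB : ∀ z, f z ∈ Set.Icc 0 B) :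
    ∀ᵐ ω ∂P, Tendsto (fun n : ℕ => (∑ i ∈ Finset.range n, ∫ z, f z ∂κ (T i ω)) / n) atTop
      (𝓝 (∫ z, f z ∂(η.bind κ))) := by
  -- A function of the type alone, written on pairs so that the independence and the common law of
  -- the pairs transfer to it directly.
  set φ : Θ × ℝ → ℝ := fun p => ∫ z, f z ∂κ p.1
  have hφ0 : Measurable fun θ => ∫ z, f z ∂κ θ :=
    hf.stronglyMeasurable.integral_kernel.measurable
  have hφ : Measurable φ := hφ0.comp measurable_fst
  have hφB : ∀ p, φ p ∈ Set.Icc 0 B := by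
    intro p
    have hi : Integrable f (κ p.1) := integrable_of_mem_Icc hf.aemeasurable hB
    refine ⟨integral_nonneg fun z => (hB z).1, ?_⟩
    have := integral_mono hi (integrable_const B) fun z => (hB z).2
    simpa using this
  have hmeas : ∀ i, AEMeasurable (fun ω => φ (T i ω, X i ω)) P := fun i =>
    hφ.comp_aemeasurable (hlaw i).aemeasurable
  have hmean : ∫ ω, φ (T 0 ω, X 0 ω) ∂P = ∫ z, f z ∂(η.bind κ) := by
    have h1 := (hlaw 0).integral_comp (f := φ) hφ.aestronglyMeasurable
    have h2 : ∫ p, φ p ∂(η ⊗ₘ κ) = ∫ θ, ∫ z, f z ∂κ θ ∂η := by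
      conv_rhs => rw [← Measure.fst_compProd η κ]
      rw [Measure.fst, integral_map measurable_fst.aemeasurable hφ0.aestronglyMeasurable]
    have h3 : ∫ z, f z ∂(η.bind κ) = ∫ θ, ∫ z, f z ∂κ θ ∂η := by
      rw [← Measure.snd_compProd, Measure.snd,
        integral_map measurable_snd.aemeasurable hf.aestronglyMeasurable]
      exact Measure.integral_compProd (integrable_of_mem_Icc (hf.comp measurable_snd).aemeasurable
        fun p => hB p.2)
    rw [h3, ← h2, ← h1]
    rfl
  have := strong_law_ae_real (μ := P) (fun i ω => φ (T i ω, X i ω))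
    (integrable_of_mem_Icc (hmeas 0) fun ω => hφB _)
    (fun i j hij => (hindep.indepFun hij).comp hφ hφ)
    (fun i => (IdentDistrib.mk (hlaw i).aemeasurable (hlaw 0).aemeasurable
      ((hlaw i).map_eq.trans (hlaw 0).map_eq.symm)).comp hφ)
  rwa [hmean] at this

lemma map_positions_eq_pi
    (hlaw : ∀ i, HasLaw (fun ω => (T i ω, X i ω)) (η ⊗ₘ κ) P)
    (hindep : iIndepFun (fun i ω => (T i ω, X i ω)) P) (n : ℕ) :
    P.map (fun ω (i : Fin n) => X i ω) = Measure.pi fun _ : Fin n => η.bind κ := by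
  have hX : iIndepFun X P := hindep.comp (fun _ => Prod.snd) fun _ => measurable_snd
  have h := hX.precomp (g := fun i : Fin n => (i : ℕ)) Fin.val_injective
  rw [(iIndepFun_iff_map_fun_eq_pi_map fun i : Fin n => (hasLaw_position hlaw i).aemeasurable).1 h]
  congr 1
  ext1 i
  exact (hasLaw_position hlaw i).map_eq

end Types

/-- Agents `i = 0, 1, 2, …` have types `T i` and positions `X i`; the pairs `(T i, X i)` are
independent with law `η(dθ) κ(dx | θ)`, and `η.bind κ` is the mixture of the `κ(· | θ)`. -/
theorem mainTheorem7
    {Θ : Type*} [MeasurableSpace Θ] (η : Measure Θ) [IsProbabilityMeasure η]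
    (κ : Kernel Θ ℝ) [IsMarkovKernel κ] (hκ : ∀ θ, κ θ (Set.Icc (0 : ℝ) 1)ᶜ = 0)
    (q : ℝ) (hq0 : 0 ≤ q) (hq1 : q ≤ 1) (y : ℝ)
    {Ω : Type*} [MeasurableSpace Ω] (P : Measure Ω) [IsProbabilityMeasure P]
    (T : ℕ → Ω → Θ) (X : ℕ → Ω → ℝ)
    (hlaw : ∀ i, HasLaw (fun ω => (T i ω, X i ω)) (η ⊗ₘ κ) P)
    (hindep : iIndepFun (fun i ω => (T i ω, X i ω)) P) :
    -- the distance on the right-hand side is finite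
    wassersteinOne (η.bind κ) (ENNReal.ofReal q • Measure.dirac y) ≠ ∞ ∧
    -- expectation over types and positions
    (∀ n : ℕ, Integrable (fun ω => socialWelfare q y (fun i : Fin n => X i ω)) P) ∧
    Tendsto (fun n : ℕ => ∫ ω, socialWelfare q y (fun i : Fin n => X i ω) ∂P) atTop
      (𝓝 (q - (wassersteinOne (η.bind κ) (ENNReal.ofReal q • Measure.dirac y)).toReal)) ∧
    -- for almost every realization of the types: expectation over the positions of independent,
    -- not identically distributed agents, the `i`-th with law `κ(· | T i)`
    (∀ᵐ ω ∂P,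
      (∀ n : ℕ, Integrable (fun x : Fin n → ℝ => socialWelfare q y x)
        (Measure.pi fun i : Fin n => κ (T i ω))) ∧
      Tendsto (fun n : ℕ =>
          ∫ x : Fin n → ℝ, socialWelfare q y x ∂(Measure.pi fun i : Fin n => κ (T i ω))) atTop
        (𝓝 (q - (wassersteinOne (η.bind κ) (ENNReal.ofReal q • Measure.dirac y)).toReal))) ∧
    -- the positions have the joint law of i.i.d. agents with common law the mixture
    (∀ n : ℕ, P.map (fun ω (i : Fin n) => X i ω) = Measure.pi fun _ : Fin n => η.bind κ) := by
  have hμ := bind_compl_Icc η κ hκ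
  have hlawX := map_positions_eq_pi hlaw hindep
  have hprob : IsProbabilityMeasure (η.bind κ) := by
    rw [← (hasLaw_position hlaw 0).map_eq]
    exact Measure.isProbabilityMeasure_map (hasLaw_position hlaw 0).aemeasurable
  obtain ⟨t, ht, hlt, hle⟩ := exists_quantile_dist (η.bind κ) hμ hq0 hq1 y
  obtain ⟨hC, hW⟩ := wassersteinOne_smul_dirac (η.bind κ) ht hlt hle
  have hXm : ∀ n : ℕ, AEMeasurable (fun ω (i : Fin n) => X i ω) P := fun n =>
    aemeasurable_pi_lambda _ fun i => (hasLaw_position hlaw i).aemeasurable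
  have hiid : ∀ n : ℕ, Integrable (fun x : Fin n → ℝ => socialWelfare q y x)
      (P.map fun ω (i : Fin n) => X i ω) := fun n => by
    rw [hlawX n]
    exact integrable_socialWelfare_pi q y _ fun _ => hμ
  have hconst : ∀ c : ℝ,
      Tendsto (fun n : ℕ => (∑ _i ∈ Finset.range n, c) / (n : ℝ)) atTop (𝓝 c) := by
    -- The average equals `c` only for `n > 0`; at `n = 0` division by zero gives `0`.
    intro c
    refine tendsto_const_nhds.congr' ?_
    filter_upwards [eventually_gt_atTop 0] with n hn
    have : (n : ℝ) ≠ 0 := by exact_mod_cast hn.ne'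
    rw [Finset.sum_const, Finset.card_range, nsmul_eq_mul, mul_div_cancel_left₀ _ this]
  have sL : MeasurableSet {z : ℝ | |z - y| < t} := measurableSet_lt (by fun_prop) (by fun_prop)
  have sF : MeasurableSet {z : ℝ | |z - y| ≤ t} := measurableSet_le (by fun_prop) (by fun_prop)
  rw [hW, ENNReal.toReal_ofReal hC]
  refine ⟨ENNReal.ofReal_ne_top, fun n => (hiid n).comp_aemeasurable (hXm n), ?_, ?_, hlawX⟩
  · have := tendsto_integral_socialWelfare (fun _ => η.bind κ) (fun _ => hμ) (η.bind κ) hq0 hq1 ht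
      hlt hle (hconst _) (hconst _) (hconst _)
    refine this.congr fun n => ?_
    rw [← hlawX n, integral_map (hXm n) (measurable_socialWelfare n q y).aestronglyMeasurable]
  -- The threshold `t` depends on the mixture only, not on the realized types, so three test
  -- functions, hence three null sets, suffice.
  · filter_upwards [
      ae_tendsto_average_integral_kernel hlaw hindep (measurable_posPart_sub_dist y t)
        (posPart_sub_dist_mem ht),
      ae_tendsto_average_integral_kernel hlaw hindep (measurable_one.indicator sL)
        (indicator_one_mem_Icc _),
      ae_tendsto_average_integral_kernel hlaw hindep (measurable_one.indicator sF)
        (indicator_one_mem_Icc _)]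
      with ω h1 h2 h3
    exact ⟨fun n => integrable_socialWelfare_pi q y _ fun _ => hκ _,
      tendsto_integral_socialWelfare (fun i => κ (T i ω)) (fun _ => hκ _) (η.bind κ) hq0 hq1 ht
        hlt hle h1 h2 h3⟩
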